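/- Let $G=(V,E)$ be a compact topological packing graph: a simple graph whose vertex set $V$ is a nonempty compact Hausdorff space and in which every finite clique is contained in an open clique. For an integer $r\ge 0$ and a continuous kernel $F\colon V\times V\to\mathbb{R}$, let $\mathcal{T}_rF\colon V^{r+2}\to\mathbb{R}$ be \[ (\mathcal{T}_rF)(x_1,\dots,x_{r+2})=\frac{1}{(r+2)!}\sum_{\pi\in S_{r+2}}F(x_{\pi(1)},x_{\pi(2)}), \] where $S_{r+2}$ is the symmetric group on $r+2$ elements, and let $\mathcal{K}_r(V)$ be the cone of all symmetric continuous kernels $F$ on $V$ with $\mathcal{T}_rF\ge 0$ everywhere. Let $\xi_r(G)^*\in[-\infty,+\infty]$ be the infimum of all $\lambda\in\mathbb{R}$ for which there is $Z\in\mathcal{K}_r(V)$ with $Z(x,x)\le\lambda-1$ for all $x\in V$ and $Z(x,y)\le-1$ for all distinct $x,y\in V$ with $(x,y)\notin E$ (so $\xi_r(G)^*=+\infty$ if there is no such $\lambda$). Then the independence number $\alpha(G)$, the maximum cardinality of an independent set of $G$, is finite, and \[ \lim_{r\to\infty}\xi_r(G)^*=\alpha(G). \] -/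

import Mathlib

open Filter Topology

namespace PackingGraph

/-- A topological graph is a packing graph if every finite clique is contained in an open clique. -/
def IsPackingGraph {V : Type*} [TopologicalSpace V] (G : SimpleGraph V) : Prop :=
  ∀ s : Finset V, G.IsClique (s : Set V) → ∃ U : Set V, IsOpen U ∧ G.IsClique U ∧ (s : Set V) ⊆ U

/-- The operator `T_r : C(V²) → C(V^{r+2})` that symmetrizes `F ⊗ 1^{⊗ r}`. -/
noncomputable def symOp {V : Type*} [TopologicalSpace V] (r : ℕ) (F : C(V × V, ℝ)) :
    C(Fin (r + 2) → V, ℝ) where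
  toFun x := (((r + 2).factorial : ℝ))⁻¹ *
    ∑ π : Equiv.Perm (Fin (r + 2)), F (x (π 0), x (π 1))
  continuous_toFun := by fun_prop

/-- The cone `K_r(V)` of symmetric continuous kernels `F` on `V` with `T_r F ≥ 0`. -/
def polyaCone (V : Type*) [TopologicalSpace V] (r : ℕ) : Set C(V × V, ℝ) :=
  {F | (∀ x y, F (x, y) = F (y, x)) ∧ 0 ≤ symOp r F}

/-- `(lam, Z)` is a feasible solution of the optimization problem defining `ξ_r(G)^*`. -/
def IsFeasible {V : Type*} [TopologicalSpace V] (G : SimpleGraph V) (r : ℕ)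
    (lam : ℝ) (Z : C(V × V, ℝ)) : Prop :=
  (∀ x, Z (x, x) ≤ lam - 1) ∧
  (∀ x y, x ≠ y → ¬ G.Adj x y → Z (x, y) ≤ -1) ∧
  Z ∈ polyaCone V r

/-- `ξ_r(G)^*`, as an extended real number; it is `+∞` if the problem is infeasible. -/
noncomputable def xiStar {V : Type*} [TopologicalSpace V] (G : SimpleGraph V) (r : ℕ) : EReal :=
  sInf {c : EReal | ∃ (lam : ℝ) (Z : C(V × V, ℝ)), IsFeasible G r lam Z ∧ c = (lam : EReal)}

end PackingGraph

/-! Lower bound: averaging `T_r Z ≥ 0` over all tuples from an independent set `s` gives `∑ Z(a,b) ≥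
0` over `s × s`, while each row sums to at most `lam - #s`. Upper bound: put `k = α(G)` and `lam >
k`. Compactness gives a continuous `f ≥ 0`, equal to 1 on the diagonal and 0 on distinct nonadjacent
pairs, with `f = 1` on some pair among any `k + 1` points (`exists_kernel`). Take `Z = lam • f - 1`.
In any tuple, the pairs with `f ≠ 1` form a graph without `(k+1)`-cliques, so Turán's theorem makes
them few enough that `T_r Z ≥ 0` for large `r` (`symOp_nonneg`). -/

namespace PackingGraph

open Finset

section Sums

/-- The symmetric group acts doubly transitively, so averaging a function of two distinct indices
over all permutations is the same as averaging it over all pairs of distinct indices. -/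
theorem card_mul_sum_perm_eq {ι : Type*} [Fintype ι] [DecidableEq ι] {i j : ι} (hij : i ≠ j)
    (g : ι → ι → ℝ) :
    (Fintype.card ι * (Fintype.card ι - 1) : ℝ) * ∑ π : Equiv.Perm ι, g (π i) (π j) =
      (Fintype.card ι).factorial * ∑ a, ∑ b, if a ≠ b then g a b else 0 := by
  have hshift (a b : ι) (hab : a ≠ b) :
      ∑ π : Equiv.Perm ι, g (π a) (π b) = ∑ π : Equiv.Perm ι, g (π i) (π j) := by
    -- The inner swap sends `i` to `a`; the outer one moves the image of `j` to `b` and fixes `a`.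
    let σ : Equiv.Perm ι := Equiv.swap (Equiv.swap i a j) b * Equiv.swap i a
    have hi : σ i = a := by
      have h : a ≠ Equiv.swap i a j := fun h => hij <| by
        rw [← Equiv.swap_apply_left i a] at h
        exact (Equiv.swap i a).injective (by simpa using h)
      simp only [σ, Equiv.Perm.mul_apply, Equiv.swap_apply_left]
      exact Equiv.swap_apply_of_ne_of_ne h hab
    have hj : σ j = b := by simp [σ]
    refine Fintype.sum_equiv (Equiv.mulRight σ) _ _ fun π => ?_
    simp [hi, hj]
  have hperm (π : Equiv.Perm ι) : (∑ a, ∑ b, if a ≠ b then g (π a) (π b) else 0) =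
      ∑ a, ∑ b, if a ≠ b then g a b else 0 := by
    refine Fintype.sum_equiv π _ _ fun a => Fintype.sum_equiv π _ _ fun b => ?_
    simp
  have hcard : (∑ a : ι, ∑ b : ι, if a ≠ b then (1 : ℝ) else 0) =
      Fintype.card ι * (Fintype.card ι - 1) := by
    have (a : ι) : (∑ b : ι, if a ≠ b then (1 : ℝ) else 0) = Fintype.card ι - 1 := by
      rw [eq_sub_iff_add_eq]
      have : (∑ b : ι, if a = b then (1 : ℝ) else 0) = 1 := by simp
      rw [← this, ← Finset.sum_add_distrib]
      rw [Finset.sum_congr rfl (g := fun _ => (1 : ℝ))]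
      · simp
      · intro b _
        by_cases h : a = b <;> simp [h]
    simp only [this, Finset.sum_const, Finset.card_univ, nsmul_eq_mul]
  calc _ = ∑ a, ∑ b, ∑ π : Equiv.Perm ι, if a ≠ b then g (π a) (π b) else 0 := by
        rw [← hcard, Finset.sum_mul]
        refine Finset.sum_congr rfl fun a _ => ?_
        rw [Finset.sum_mul]
        refine Finset.sum_congr rfl fun b _ => ?_
        by_cases h : a = b
        · simp [h]
        · simp [h, hshift a b h]
    _ = ∑ π : Equiv.Perm ι, ∑ a, ∑ b, if a ≠ b then g (π a) (π b) else 0 := by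
        rw [Finset.sum_comm (s := (univ : Finset (Equiv.Perm ι)))]
        exact Finset.sum_congr rfl fun a _ => Finset.sum_comm
    _ = _ := by
        simp only [hperm, Finset.sum_const, Finset.card_univ, Fintype.card_perm, nsmul_eq_mul]

theorem sum_tuple_eq {S : Type*} [Fintype S] (r : ℕ) (g : S → S → ℝ) :
    ∑ x : Fin (r + 2) → S, g (x 0) (x 1) = (Fintype.card S : ℝ) ^ r * ∑ a, ∑ b, g a b := by
  rw [← (Fin.consEquiv fun _ : Fin (r + 2) => S).sum_comp, Fintype.sum_prod_type, Finset.mul_sum]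
  refine Finset.sum_congr rfl fun a _ => ?_
  rw [← (Fin.consEquiv fun _ : Fin (r + 1) => S).sum_comp, Fintype.sum_prod_type, Finset.mul_sum]
  refine Finset.sum_congr rfl fun b _ => ?_
  change ∑ _y : Fin r → S, g a b = _
  simp

/-- Turán's theorem as an upper bound for the number of ordered adjacent pairs. -/
theorem mul_sum_adj_le {n k : ℕ} (hk : 0 < k) (H : SimpleGraph (Fin n)) [DecidableRel H.Adj]
    (hH : H.CliqueFree (k + 1)) :
    (k : ℝ) * ∑ a, ∑ b, (if H.Adj a b then (1 : ℝ) else 0) ≤ (k - 1) * (n : ℝ) ^ 2 := by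
  have h1 : #H.edgeFinset ≤ #(SimpleGraph.turanGraph n k).edgeFinset :=
    (SimpleGraph.isTuranMaximal_turanGraph hk).2 hH
  have h2 : 2 * k * #H.edgeFinset ≤ (k - 1) * n ^ 2 :=
    (Nat.mul_le_mul_left _ h1).trans SimpleGraph.mul_card_edgeFinset_turanGraph_le
  have h3 : ∑ a, ∑ b, (if H.Adj a b then (1 : ℝ) else 0) = 2 * #H.edgeFinset := by
    have := H.sum_degrees_eq_twice_card_edges
    rw [← Nat.cast_inj (R := ℝ)] at this
    push_cast at this
    rw [← this]
    refine Finset.sum_congr rfl fun a _ => ?_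
    rw [← SimpleGraph.card_neighborFinset_eq_degree, SimpleGraph.neighborFinset_eq_filter]
    simp
  rw [h3]
  have h4 : ((2 * k * #H.edgeFinset : ℕ) : ℝ) ≤ ((k - 1) * n ^ 2 : ℕ) := Nat.cast_le.2 h2
  push_cast [Nat.cast_sub (Nat.succ_le_of_lt hk)] at h4
  linarith

end Sums

variable {V : Type*} [TopologicalSpace V] {G : SimpleGraph V}

theorem IsPackingGraph.isOpen_eq_or_adj (hG : IsPackingGraph G) :
    IsOpen {p : V × V | p.1 = p.2 ∨ G.Adj p.1 p.2} := by
  classical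
  refine isOpen_iff_forall_mem_open.2 fun p hp => ?_
  obtain ⟨U, hU, hc, hsub⟩ := hG {p.1, p.2} (by
    rcases hp with h | h
    · simp [h]
    · simpa [SimpleGraph.isClique_pair] using fun _ => h)
  refine ⟨U ×ˢ U, fun q hq => ?_, hU.prod hU, hsub (by simp), hsub (by simp)⟩
  by_cases h : q.1 = q.2
  · exact Or.inl h
  · exact Or.inr (hc hq.1 hq.2 h)

/-- Finitely many open cliques cover `V`, and an independent set meets each in at most one point. -/
theorem IsPackingGraph.bddAbove [CompactSpace V] (hG : IsPackingGraph G) :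
    BddAbove {n : ℕ | ∃ s : Finset V, G.IsNIndepSet n s} := by
  classical
  choose U hU hc hsub using fun x : V => hG {x} (by simp)
  have hx (x : V) : x ∈ U x := hsub x (by simp)
  obtain ⟨t, ht⟩ := CompactSpace.elim_nhds_subcover U fun x => (hU x).mem_nhds (hx x)
  refine ⟨#t, ?_⟩
  rintro n ⟨s, hs, rfl⟩
  have hcov (x : V) : ∃ y ∈ t, x ∈ U y := by
    simpa using (ht.symm ▸ Set.mem_univ x : x ∈ ⋃ y ∈ t, U y)
  choose c hct hcU using hcov
  refine Finset.card_le_card_of_injOn c (fun x _ => hct x) fun x hxs y hys hxy => ?_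
  by_contra hne
  exact hs hxs hys hne (hc (c x) (hcU x) (hxy ▸ hcU y) hne)

/-- Averaging `T_r Z` over the tuples from an independent set bounds the objective from below. -/
theorem IsFeasible.card_le {r : ℕ} {lam : ℝ} {Z : C(V × V, ℝ)} (h : IsFeasible G r lam Z)
    {s : Finset V} (hs : G.IsIndepSet (s : Set V)) (hne : s.Nonempty) : (#s : ℝ) ≤ lam := by
  classical
  obtain ⟨hdiag, hoff, -, hpos⟩ := h
  have hpos' (x : Fin (r + 2) → s) :
      0 ≤ ∑ π : Equiv.Perm (Fin (r + 2)), Z (x (π 0), x (π 1)) := by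
    have := hpos fun i => (x i : V)
    simp only [symOp] at this
    exact nonneg_of_mul_nonneg_right this (by positivity)
  have hsum : 0 ≤ ∑ x : Fin (r + 2) → s, ∑ π : Equiv.Perm (Fin (r + 2)), Z (x (π 0), x (π 1)) :=
    Finset.sum_nonneg fun x _ => hpos' x
  -- Permuting coordinates permutes the tuples from `s`. Tuples may repeat points, so the diagonal
  -- terms are included.
  have hinv (π : Equiv.Perm (Fin (r + 2))) :
      ∑ x : Fin (r + 2) → s, Z (x (π 0), x (π 1)) =
        (Fintype.card s : ℝ) ^ r * ∑ a : s, ∑ b : s, Z (a, b) := by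
    rw [← sum_tuple_eq r fun a b : s => Z (a, b)]
    exact (Equiv.arrowCongr π.symm (Equiv.refl s)).sum_comp
      fun x : Fin (r + 2) → s => Z (x 0, x 1)
  rw [Finset.sum_comm, Finset.sum_congr rfl fun π _ => hinv π, Finset.sum_const, nsmul_eq_mul,
    ← mul_assoc] at hsum
  have hs0 : 0 < Fintype.card s := by simpa using hne
  have hcard : (0 : ℝ) < #s := by exact_mod_cast hne.card_pos
  have hav : 0 ≤ ∑ a : s, ∑ b : s, Z (a, b) :=
    nonneg_of_mul_nonneg_right hsum (mul_pos (by simp [Fintype.card_perm, Nat.factorial_pos])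
      (by positivity))
  have hrow (a : s) : ∑ b : s, Z (a, b) ≤ lam - #s := by
    calc ∑ b : s, Z (a, b) ≤ ∑ b : s, ((if a = b then lam else 0) - 1) := by
          refine Finset.sum_le_sum fun b _ => ?_
          by_cases hab : a = b
          · simpa [hab] using hdiag b
          · have hab' : (a : V) ≠ b := fun h => hab (Subtype.ext h)
            simpa [hab] using hoff a b hab' (hs a.2 b.2 hab')
      _ = lam - #s := by simp [Finset.sum_sub_distrib]
  have : 0 ≤ (#s : ℝ) * (lam - #s) := by
    calc 0 ≤ ∑ a : s, ∑ b : s, Z (a, b) := hav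
      _ ≤ ∑ _a : s, (lam - #s) := Finset.sum_le_sum fun a _ => hrow a
      _ = _ := by rw [Finset.sum_const, nsmul_eq_mul, Finset.card_univ, Fintype.card_coe]
  linarith [nonneg_of_mul_nonneg_right this hcard]

/-- The closed adjacency relation can be shrunk to a closed relation without creating larger
independent sets. -/
theorem IsPackingGraph.exists_isClosed_subset [T2Space V] [CompactSpace V]
    (hG : IsPackingGraph G) {k : ℕ} (hk : ∀ s : Finset V, ¬ G.IsNIndepSet (k + 1) s) :
    ∃ K : Set (V × V), IsClosed K ∧ K ⊆ {p | p.1 = p.2 ∨ G.Adj p.1 p.2} ∧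
      ∀ x : Fin (k + 1) → V, ∃ i j, i ≠ j ∧ (x i, x j) ∈ K := by
  classical
  have hO := hG.isOpen_eq_or_adj
  have hcov (x : Fin (k + 1) → V) : ∃ i j, i ≠ j ∧ (x i = x j ∨ G.Adj (x i) (x j)) := by
    by_contra! hcon
    refine hk (univ.image x) ⟨?_, ?_⟩
    · intro a ha b hb hab
      simp only [coe_image, coe_univ, Set.image_univ, Set.mem_range] at ha hb
      obtain ⟨i, rfl⟩ := ha
      obtain ⟨j, rfl⟩ := hb
      exact (hcon i j fun h => hab (h ▸ rfl)).2
    · rw [Finset.card_image_of_injective]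
      · simp
      · intro i j hij
        by_contra hne
        exact (hcon i j hne).1 hij
  choose i j hij hx using hcov
  -- Regularity of `V × V` gives closed neighbourhoods inside the open relation; a finite subcover
  -- keeps their union closed.
  choose W hW hWc hWO using fun x : Fin (k + 1) → V =>
    exists_mem_nhds_isClosed_subset (hO.mem_nhds (x := (x (i x), x (j x))) (hx x))
  obtain ⟨t, ht⟩ := CompactSpace.elim_nhds_subcover
    (fun x => (fun y : Fin (k + 1) → V => (y (i x), y (j x))) ⁻¹' W x) fun x =>
      ContinuousAt.preimage_mem_nhds (by fun_prop) (hW x)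
  refine ⟨⋃ x ∈ t, W x, t.finite_toSet.isClosed_biUnion fun x _ => hWc x,
    Set.iUnion₂_subset fun x _ => hWO x, fun y => ?_⟩
  have hy := ht.ge (Set.mem_univ y)
  obtain ⟨x, hxt, hyx⟩ := Set.mem_iUnion₂.1 hy
  exact ⟨i x, j x, hij x, Set.mem_iUnion₂.2 ⟨x, hxt, hyx⟩⟩

/-- A continuous minorant of the closed adjacency relation that keeps the independence number. -/
theorem IsPackingGraph.exists_kernel [T2Space V] [CompactSpace V]
    (hG : IsPackingGraph G) {k : ℕ} (hk : ∀ s : Finset V, ¬ G.IsNIndepSet (k + 1) s) :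
    ∃ f : C(V × V, ℝ), (∀ x y, f (x, y) = f (y, x)) ∧ (∀ p, 0 ≤ f p) ∧ (∀ x, f (x, x) = 1) ∧
      (∀ x y, x ≠ y → ¬ G.Adj x y → f (x, y) = 0) ∧
      ∀ x : Fin (k + 1) → V, ∃ i j, i ≠ j ∧ f (x i, x j) = 1 := by
  obtain ⟨K, hK, hKO, hcov⟩ := hG.exists_isClosed_subset hk
  -- Including the swap of `K` keeps the value 1 on `K` after `g` is symmetrized.
  let L : Set (V × V) := (K ∪ Prod.swap ⁻¹' K) ∪ Set.diagonal V
  have hL : IsClosed L := (hK.union (hK.preimage continuous_swap)).union isClosed_diagonal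
  obtain ⟨g, hg0, hg1, hgI⟩ := exists_continuous_zero_one_of_isClosed
    hG.isOpen_eq_or_adj.isClosed_compl hL (by
      refine Set.disjoint_left.2 fun p hp hpL => hp ?_
      rcases hpL with (h | h) | h
      · exact hKO h
      · exact (hKO h).imp Eq.symm SimpleGraph.Adj.symm
      · exact Or.inl h)
  refine ⟨⟨fun p => (g p + g p.swap) / 2, by fun_prop⟩, fun x y => ?_, fun p => ?_, fun x => ?_,
    fun x y hxy hadj => ?_, fun x => ?_⟩
  · simp [add_comm]
  · have h1 := (hgI p).1
    have h2 := (hgI p.swap).1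
    simp only [ContinuousMap.coe_mk]
    positivity
  · have : g (x, x) = 1 := hg1 (Or.inr rfl)
    simp [this]
  · have h1 : g (x, y) = 0 := hg0 (by simp [hxy, hadj])
    have h2 : g (y, x) = 0 := hg0 (by simp [hxy.symm, G.adj_comm y x, hadj])
    simp [h1, h2]
  · obtain ⟨i, j, hij, hx⟩ := hcov x
    have h1 : g (x i, x j) = 1 := hg1 (Or.inl (Or.inl hx))
    have h2 : g (x j, x i) = 1 := hg1 (Or.inl (Or.inr hx))
    exact ⟨i, j, hij, by simp [h1, h2]⟩

theorem symOp_nonneg {r k : ℕ} (hk : 0 < k) {lam : ℝ} (hlam : (k : ℝ) < lam)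
    (hr : k * lam / (lam - k) ≤ (r : ℝ)) {f : C(V × V, ℝ)}
    (hsymm : ∀ x y, f (x, y) = f (y, x)) (hpos : ∀ p, 0 ≤ f p) (hdiag : ∀ x, f (x, x) = 1)
    (hcov : ∀ x : Fin (k + 1) → V, ∃ i j, i ≠ j ∧ f (x i, x j) = 1) :
    0 ≤ symOp r (lam • f - 1) := by
  classical
  intro x
  have hk' : (0 : ℝ) < k := by exact_mod_cast hk
  -- The vertices are indices, since points of the tuple may repeat; equal points are nonadjacent
  -- because `f = 1` there.
  let H : SimpleGraph (Fin (r + 2)) :=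
    { Adj := fun a b => f (x a, x b) ≠ 1
      symm := ⟨fun a b h => by rwa [hsymm]⟩
      loopless := ⟨fun a h => h (hdiag _)⟩ }
  have hH : H.CliqueFree (k + 1) := by
    intro s hs
    let e := s.equivFinOfCardEq hs.card_eq
    obtain ⟨i, j, hij, hf⟩ := hcov fun i => x (e.symm i)
    exact hs.isClique (e.symm i).2 (e.symm j).2
      (fun h => hij (e.symm.injective (Subtype.ext h))) hf
  have hT := mul_sum_adj_le hk H hH
  set E : ℝ := ∑ a, ∑ b, (if H.Adj a b then (1 : ℝ) else 0) with hE
  have hsum : (lam - 1) * (r + 2) ^ 2 - (lam - 1) * (r + 2) - lam * E ≤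
      ∑ a : Fin (r + 2), ∑ b, if a ≠ b then (lam * f (x a, x b) - 1) else 0 := by
    have : (lam - 1) * (r + 2) ^ 2 - (lam - 1) * (r + 2) - lam * E =
        ∑ a : Fin (r + 2), ∑ b,
          ((lam - 1) - (if a = b then lam - 1 else 0) - lam * if H.Adj a b then 1 else 0) := by
      simp only [Finset.sum_sub_distrib, ← Finset.mul_sum, ← hE]
      simp
      ring
    rw [this]
    -- Off the diagonal, a pair with `f = 1` contributes `lam - 1`, and any other at least `-1`.
    refine Finset.sum_le_sum fun a _ => Finset.sum_le_sum fun b _ => ?_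
    by_cases hab : a = b
    · simp [hab]
    · have h0 := mul_nonneg (hk'.trans hlam).le (hpos (x a, x b))
      by_cases hf : f (x a, x b) = 1
      · have : ¬ H.Adj a b := fun h => h hf
        simp [hab, this, hf]
      · have : H.Adj a b := hf
        simp [hab, this, h0]
  have hpair : 0 ≤ ∑ a : Fin (r + 2), ∑ b, if a ≠ b then (lam * f (x a, x b) - 1) else 0 := by
    refine le_trans ?_ hsum
    rw [div_le_iff₀ (sub_pos.2 hlam)] at hr
    push_cast at hT
    refine nonneg_of_mul_nonneg_right (a := (k : ℝ)) ?_ hk'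
    have h1 := mul_le_mul_of_nonneg_left hT (hk'.trans hlam).le
    -- With `n = r + 2`, Turán bounds `k` times the pair sum below by `n * ((lam - k) * n - k * (lam
    -- - 1))`; `hr` makes this nonnegative.
    have h2 : 0 ≤ ((r : ℝ) + 2) * ((lam - k) * (r + 2) - k * lam + k) :=
      mul_nonneg (by positivity) (by nlinarith)
    nlinarith
  have hperm := card_mul_sum_perm_eq (show (0 : Fin (r + 2)) ≠ 1 by simp)
    fun a b => lam * f (x a, x b) - 1
  simp only [symOp]
  refine mul_nonneg (by positivity) ?_
  refine nonneg_of_mul_nonneg_right (a := ((r : ℝ) + 2) * (r + 1)) ?_ (by positivity)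
  have h : 0 ≤ (((r + 2).factorial : ℕ) : ℝ) *
      ∑ a : Fin (r + 2), ∑ b, if a ≠ b then (lam * f (x a, x b) - 1) else 0 :=
    mul_nonneg (by positivity) hpair
  simp only [Fintype.card_fin] at hperm
  rw [← hperm] at h
  push_cast at h
  rw [add_sub_assoc] at h
  norm_num at h ⊢
  exact h

theorem IsPackingGraph.eventually_exists_isFeasible [T2Space V] [CompactSpace V]
    (hG : IsPackingGraph G) {k : ℕ} (hk0 : 0 < k) (hk : ∀ s : Finset V, ¬ G.IsNIndepSet (k + 1) s)
    {lam : ℝ} (hlam : (k : ℝ) < lam) :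
    ∀ᶠ r : ℕ in atTop, ∃ Z : C(V × V, ℝ), IsFeasible G r lam Z := by
  obtain ⟨f, hsymm, hpos, hdiag, hoff, hcov⟩ := hG.exists_kernel hk
  filter_upwards [tendsto_natCast_atTop_atTop.eventually_ge_atTop (k * lam / (lam - k))] with r hr
  refine ⟨lam • f - 1, fun x => ?_, fun x y hxy hadj => ?_, fun x y => ?_, ?_⟩
  · simp [hdiag]
  · simp [hoff x y hxy hadj]
  · simp [hsymm x y]
  · exact symOp_nonneg hk0 hlam hr hsymm hpos hdiag hcov

end PackingGraph

theorem theorem3p3 {V : Type*} [TopologicalSpace V] [T2Space V] [CompactSpace V] [Nonempty V]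
    (G : SimpleGraph V) (hG : PackingGraph.IsPackingGraph G) :
    BddAbove {n : ℕ | ∃ s : Finset V, G.IsNIndepSet n s} ∧
      Tendsto (fun r : ℕ => PackingGraph.xiStar G r) atTop (𝓝 ((G.indepNum : ℝ) : EReal)) := by
  have hbdd := hG.bddAbove
  refine ⟨hbdd, ?_⟩
  -- `indepNum` is a supremum in `ℕ`, attained because the set is bounded and contains 0.
  obtain ⟨s, hs⟩ : ∃ s : Finset V, G.IsNIndepSet G.indepNum s :=
    Nat.sSup_mem (s := {n | ∃ s : Finset V, G.IsNIndepSet n s})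
      ⟨0, ∅, by simp [SimpleGraph.isNIndepSet_iff]⟩ hbdd
  have hpos : 0 < G.indepNum := by
    obtain ⟨v⟩ := ‹Nonempty V›
    exact le_csSup (a := 1) hbdd ⟨{v}, by simp [SimpleGraph.isNIndepSet_iff]⟩
  have hmax (t : Finset V) : ¬ G.IsNIndepSet (G.indepNum + 1) t := fun ht =>
    (Nat.lt_succ_self _).not_ge (le_csSup hbdd ⟨t, ht⟩)
  refine tendsto_order.2 ⟨fun a ha => Eventually.of_forall fun r => ha.trans_le ?_, fun b hb => ?_⟩
  · refine le_sInf ?_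
    rintro _ ⟨lam, Z, hZ, rfl⟩
    have := hZ.card_le hs.isIndepSet (Finset.card_pos.1 (hs.card_eq ▸ hpos))
    rw [hs.card_eq] at this
    exact_mod_cast this
  · obtain ⟨lam, h1, h2⟩ := EReal.lt_iff_exists_real_btwn.1 hb
    filter_upwards [hG.eventually_exists_isFeasible hpos hmax (EReal.coe_lt_coe_iff.1 h1)]
      with r ⟨Z, hZ⟩
    refine lt_of_le_of_lt (sInf_le ?_) h2
    exact ⟨lam, Z, hZ, rfl⟩
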